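/- Let $(X,d)$ be a compact metric space and let $\mathrm{Hom}(X)$ be the space of homeomorphisms $X\to X$ with the metric $d_{C^0}(f,g)=\max_{x\in X}d(f(x),g(x))$. Let $f\in \mathrm{Hom}(X)$. For a metric $\rho$ on $X$ compatible with its topology, a point $x\in X$ is strong chain recurrent for $(f,\rho)$ if for every $\varepsilon>0$ there are $n\ge 1$ and points $x=x_1,x_2,\dots,x_n,x_{n+1}=x$ of $X$ with $\sum_{i=1}^n\rho(f(x_i),x_{i+1})<\varepsilon$. The set of these points is $\mathcal{SCR}_\rho(f)$. The generalized recurrent set is $\mathcal{GR}(f)=\bigcap_\rho \mathcal{SCR}_\rho(f)$, the intersection being over all metrics $\rho$ on $X$ compatible with the topology of $X$. If $\mathcal{GR}(f)\neq X$, we say that $f$ does not permit $\mathcal{GR}$-explosions if for every open set $U\supseteq\mathcal{GR}(f)$ there is a neighborhood $N$ of $f$ in $\mathrm{Hom}(X)$ such that $\mathcal{GR}(g)\subseteq U$ for all $g\in N$. An open decomposition of $f$ is a finite family $V_1,\dots,V_k$ of open subsets of $X$ with pairwise disjoint closures such that $\mathcal{GR}(f)\subseteq\bigcup_{i=1}^kV_i$.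 For $i\ne j$ write $V_i\ge V_j$ if there are $x\in V_j$ and $m\ge 0$ with $f^{-m}(x)\in V_i$. For $r>1$, the sets $V_{i_1},\dots,V_{i_r}$ form an $r$ cycle if $V_{i_1}\ge V_{i_2}\ge\dots\ge V_{i_r}\ge V_{i_1}$. The set $V_j$ forms a $1$ cycle if there are $x\notin V_j$ and integers $m,q>0$ with $f^m(x)\in V_j$ and $f^{-q}(x)\in V_j$. The open decomposition has no cycles if no members of it form an $r$ cycle, for any $r\ge 1$. **Theorem.** Let $M$ be a compact topological manifold (without boundary, with a metric $d$ compatible with its topology) of dimension at least $2$, and let $f\in\mathrm{Hom}(M)$ be such that $\mathcal{GR}(f)\ne M$. If $f$ does not permit $\mathcal{GR}$-explosions, then for every open neighborhood $U$ of $\mathcal{GR}(f)$ there is an open decomposition $V_1,\dots,V_k$ of $f$ with no cycles such that $$\mathcal{GR}(f)\subseteq\bigcup_{i=1}^kV_i\subseteq U.$$ -/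

import Mathlib

open Set Topology

namespace GenRec

/-- The space `Hom(X)` of homeomorphisms of a compact metric space, as a metric space for the
uniform distance `d_{C⁰}(f, g) = max_x d (f x) (g x)` (see `dist_homeo_eq`). -/
noncomputable instance homeoMetricSpace {X : Type*} [MetricSpace X] [CompactSpace X] :
    MetricSpace (X ≃ₜ X) :=
  MetricSpace.induced (fun f : X ≃ₜ X => (⟨f, f.continuous⟩ : C(X, X)))
    (fun _ _ h => Homeomorph.ext fun x => DFunLike.congr_fun h x) inferInstance

theorem dist_homeo_eq {X : Type*} [MetricSpace X] [CompactSpace X] (f g : X ≃ₜ X) :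
    dist f g = ⨆ x, dist (f x) (g x) :=
  ContinuousMap.dist_eq_iSup (f := ⟨f, f.continuous⟩) (g := ⟨g, g.continuous⟩)

/-- There is a strong `ε`-chain of `f` from `x` to `y` for the distance function `d`: points
`c 0 = x, c 1, …, c (n - 1)` with `n ≥ 1` such that, with `c n = y`, the jumps
`d (f (c i)) (c (i + 1))`, `i < n`, have sum less than `ε`. -/
def StrongChain {X : Type*} (d : X → X → ℝ) (f : X → X) (ε : ℝ) (x y : X) : Prop :=
  ∃ n : ℕ, 1 ≤ n ∧ ∃ c : ℕ → X, c 0 = x ∧ c n = y ∧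
    ∑ i ∈ Finset.range n, d (f (c i)) (c (i + 1)) < ε

/-- The strong chain recurrent set of `f` for the distance function `d`. -/
def strongChainRecurrentSet {X : Type*} (d : X → X → ℝ) (f : X → X) : Set X :=
  {x | ∀ ε : ℝ, 0 < ε → StrongChain d f ε x x}

/-- The generalized recurrent set of `f`: the intersection of the strong chain recurrent sets
of `f` over all metrics that induce the topology of `X`. -/
def generalizedRecurrentSet {X : Type*} [t : TopologicalSpace X] (f : X → X) : Set X :=
  ⋂ (m : MetricSpace X) (_ : m.toUniformSpace.toTopologicalSpace = t),
    strongChainRecurrentSet m.dist f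

/-- `f` does not permit explosions of the generalized recurrent set. -/
def NoGRExplosions {X : Type*} [MetricSpace X] [CompactSpace X] (f : X ≃ₜ X) : Prop :=
  ∀ U : Set X, IsOpen U → generalizedRecurrentSet f ⊆ U →
    ∃ N ∈ 𝓝 f, ∀ g ∈ N, generalizedRecurrentSet g ⊆ U

/-- The set `V^u` of the points `x` with `f⁻ᵐ x ∈ V` for some `m ≥ 0`. -/
def unstableSet {X : Type*} [TopologicalSpace X] (f : X ≃ₜ X) (V : Set X) : Set X :=
  {x | ∃ m : ℕ, f.symm^[m] x ∈ V}

/-- `V 0, …, V (k - 1)` is an open decomposition of `f`. -/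
structure IsOpenDecomposition {X : Type*} [TopologicalSpace X] (f : X ≃ₜ X) {k : ℕ}
    (V : Fin k → Set X) : Prop where
  isOpen : ∀ i, IsOpen (V i)
  disjoint_closure : ∀ i j, i ≠ j → Disjoint (closure (V i)) (closure (V j))
  subset_iUnion : generalizedRecurrentSet f ⊆ ⋃ i, V i

/-- The relation `V i ≥ V j` between two different members of the family. -/
def Leads {X : Type*} [TopologicalSpace X] (f : X ≃ₜ X) {k : ℕ} (V : Fin k → Set X)
    (i j : Fin k) : Prop :=
  i ≠ j ∧ (V j ∩ unstableSet f (V i)).Nonempty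

/-- `V (s 0) ≥ V (s 1) ≥ … ≥ V (s (r - 1)) ≥ V (s 0)`, with `r > 1`; `finRotate r` is the
cyclic successor on `Fin r`. -/
def IsLongCycle {X : Type*} [TopologicalSpace X] (f : X ≃ₜ X) {k : ℕ} (V : Fin k → Set X)
    (r : ℕ) (s : Fin r → Fin k) : Prop :=
  1 < r ∧ ∀ a : Fin r, Leads f V (s a) (s (finRotate r a))

/-- `V j` forms a `1` cycle: some orbit leaves `V j` and comes back to it. -/
def IsOneCycle {X : Type*} [TopologicalSpace X] (f : X ≃ₜ X) {k : ℕ} (V : Fin k → Set X)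
    (j : Fin k) : Prop :=
  ∃ x, x ∉ V j ∧ ∃ m q : ℕ, 0 < m ∧ 0 < q ∧ f^[m] x ∈ V j ∧ f.symm^[q] x ∈ V j

/-- The family `V` has no `r` cycles for any `r ≥ 1`. -/
def HasNoCycles {X : Type*} [TopologicalSpace X] (f : X ≃ₜ X) {k : ℕ} (V : Fin k → Set X) :
    Prop :=
  (∀ (r : ℕ) (s : Fin r → Fin k), ¬ IsLongCycle f V r s) ∧ ∀ j : Fin k, ¬ IsOneCycle f V j

end GenRec

/-!
Every point outside `U` fails to be chain recurrent. Indeed, on a manifold of dimension at least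
`2` a chain recurrent point `x` becomes periodic after an arbitrarily small `C⁰` perturbation of
`f`: cut a short chain from `x` to `x` down to one without repetitions and compose `f` with a
homeomorphism close to the identity that closes all the gaps. So `x` is in the generalized
recurrent set of maps arbitrarily close to `f`, which must be contained in `U` because there are
no explosions.

If `x` is not chain recurrent, the set of points reached from `x` by `ε`-chains is, for small `ε`,
an attractor block that contains `f x` but whose closure does not contain `x`. By compactness
finitely many blocks `Ω i` suffice for all the points outside `U`. Grouping points according to
the blocks that contain them gives an open decomposition inside `U`, and since orbits never leave
a block, an orbit that goes from one cell to another can only increase the set of blocks, which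
excludes cycles.

The gaps are closed inside charts. For two generic functionals `u` and `v`, a finite set of small
displacements splits into a part in `ker u` and a part in `ker v`. As `u` takes distinct values at
the points to be moved, a cut-off shear `z ↦ z + χ z • φ (u z)` with `φ` valued in `ker u`
realizes the first part, and similarly for `v`.
-/

open Filter Relation
open scoped NNReal

namespace GenRec

/-! ### Chain recurrence and attractor blocks -/

/-- `y` follows `x` in an `ε`-chain of `f`. -/
def ChainStep {X : Type*} [PseudoMetricSpace X] (f : X → X) (ε : ℝ) (x y : X) : Prop :=
  dist (f x) y < ε

/-- The points reached from `x` by `ε`-chains of `f` with at least one step. -/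
def chainReach {X : Type*} [PseudoMetricSpace X] (f : X → X) (ε : ℝ) (x : X) : Set X :=
  {y | TransGen (ChainStep f ε) x y}

/-- The chain recurrent set of `f`, in the sense of Conley. -/
def chainRecurrentSet {X : Type*} [PseudoMetricSpace X] (f : X → X) : Set X :=
  {x | ∀ ε : ℝ, 0 < ε → x ∈ chainReach f ε x}

/-- An attractor block of `f`, in the sense of Conley: an open set into which `f` maps its own
closure. -/
structure IsAttractorBlock {X : Type*} [TopologicalSpace X] (f : X → X) (Ω : Set X) : Prop where
  isOpen : IsOpen Ω
  mapsTo_closure : MapsTo f (closure Ω) Ω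

section Chains

variable {X : Type*} [PseudoMetricSpace X] {f : X → X} {ε δ : ℝ} {x y : X}

theorem ChainStep.mono (h : ε ≤ δ) (hxy : ChainStep f ε x y) : ChainStep f δ x y :=
  lt_of_lt_of_le hxy h

theorem ChainStep.trans_dist {z : X} (hxy : ChainStep f ε x y) (hyz : dist y z ≤ δ) :
    ChainStep f (ε + δ) x z :=
  (dist_triangle _ y _).trans_lt (add_lt_add_of_lt_of_le hxy hyz)

theorem apply_mem_chainReach (hε : 0 < ε) : f x ∈ chainReach f ε x :=
  .single (by simpa [ChainStep] using hε)

theorem isOpen_chainReach : IsOpen (chainReach f ε x) := by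
  refine isOpen_iff_mem_nhds.2 fun y hy => ?_
  obtain ⟨z, hxz, hzy⟩ := TransGen.tail'_iff.1 hy
  have hopen : IsOpen {w | ChainStep f ε z w} :=
    isOpen_lt (continuous_const.dist continuous_id) continuous_const
  exact Filter.mem_of_superset (hopen.mem_nhds hzy) fun w hzw => TransGen.tail' hxz hzw

theorem isAttractorBlock_chainReach (hf : Continuous f) (hε : 0 < ε) :
    IsAttractorBlock f (chainReach f ε x) where
  isOpen := isOpen_chainReach
  mapsTo_closure y hy := by
    obtain ⟨z, hzy, hxz⟩ := mem_closure_iff.1 hy (f ⁻¹' Metric.ball (f y) ε)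
      (Metric.isOpen_ball.preimage hf) (by simpa using hε)
    exact TransGen.tail hxz hzy

theorem mem_chainReach_of_mem_closure (hε : 0 < ε) (hy : y ∈ closure (chainReach f (ε / 2) x)) :
    y ∈ chainReach f ε x := by
  obtain ⟨z, hxz, hyz⟩ := Metric.mem_closure_iff.1 hy (ε / 2) (half_pos hε)
  obtain ⟨w, hxw, hwz⟩ := TransGen.tail'_iff.1 hxz
  refine TransGen.tail' (ReflTransGen.mono
    (fun _ _ => ChainStep.mono (half_le_self hε.le)) _ _ hxw) ?_
  exact (hwz.trans_dist (dist_comm y z ▸ hyz.le)).mono (add_halves ε).le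

end Chains

theorem StrongChain.mem_chainReach {X : Type*} [PseudoMetricSpace X] {f : X → X} {ε : ℝ} {x y : X}
    (h : StrongChain dist f ε x y) : y ∈ chainReach f ε x := by
  obtain ⟨n, hn, c, rfl, rfl, hsum⟩ := h
  have hstep : ∀ i < n, ChainStep f ε (c i) (c (i + 1)) := fun i hi =>
    (Finset.single_le_sum (f := fun i => dist (f (c i)) (c (i + 1)))
      (fun _ _ => dist_nonneg) (Finset.mem_range.2 hi)).trans_lt hsum
  exact (transGen_of_succ_of_lt (fun i j => ChainStep f ε (c i) (c j))
    (fun i hi => hstep i hi.2) hn).lift c fun _ _ => id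

theorem generalizedRecurrentSet_subset_chainRecurrentSet {X : Type*} [MetricSpace X] (f : X → X) :
    generalizedRecurrentSet f ⊆ chainRecurrentSet f := fun _ hx ε hε =>
  (mem_iInter₂.1 hx inferInstance rfl ε hε).mem_chainReach

theorem periodicPts_subset_generalizedRecurrentSet {X : Type*} [TopologicalSpace X] (f : X → X) :
    Function.periodicPts f ⊆ generalizedRecurrentSet f := by
  rintro x ⟨n, hn, hx⟩
  refine mem_iInter₂.2 fun m _ ε hε => ⟨n, hn, fun i => f^[i] x, rfl, hx, ?_⟩
  simpa only [Function.iterate_succ_apply', dist_self, Finset.sum_const_zero] using hε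

namespace IsAttractorBlock

theorem mapsTo {X : Type*} [TopologicalSpace X] {f : X → X} {Ω : Set X}
    (hΩ : IsAttractorBlock f Ω) : MapsTo f Ω Ω :=
  hΩ.mapsTo_closure.mono_left subset_closure

theorem preimage {X : Type*} [TopologicalSpace X] {f : X → X} {Ω : Set X}
    (hΩ : IsAttractorBlock f Ω) (hf : Continuous f) : IsAttractorBlock f (f ⁻¹' Ω) where
  isOpen := hΩ.isOpen.preimage hf
  mapsTo_closure _ hy := hΩ.mapsTo_closure (hf.closure_preimage_subset Ω hy)

variable {X : Type*} [PseudoMetricSpace X] [CompactSpace X] {f : X → X} {Ω : Set X} {y : X}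

theorem mem_of_apply_mem (hΩ : IsAttractorBlock f Ω) (hf : Continuous f)
    (hy : y ∈ chainRecurrentSet f) (hfy : f y ∈ Ω) : y ∈ Ω := by
  have hK : IsCompact (insert (f y) (f '' closure Ω)) :=
    (isClosed_closure.isCompact.image hf).insert (f y)
  obtain ⟨δ, hδ, hδΩ⟩ := hK.exists_thickening_subset_open hΩ.isOpen
    (insert_subset hfy hΩ.mapsTo_closure.image_subset)
  have mem_of_step : ∀ {a b}, f a ∈ insert (f y) (f '' closure Ω) → ChainStep f δ a b → b ∈ Ω :=
    fun ha hab => hδΩ (Metric.mem_thickening_iff.2 ⟨_, ha, by rwa [dist_comm]⟩)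
  have chain_mem : ∀ z ∈ chainReach f δ y, z ∈ Ω := fun z hz => by
    induction hz with
    | single hstep => exact mem_of_step (mem_insert _ _) hstep
    | tail _ hstep hb =>
      exact mem_of_step (mem_insert_of_mem _ (mem_image_of_mem f (subset_closure hb))) hstep
  exact chain_mem y (hy δ hδ)

-- The image `f y` lies in the block `f ⁻¹' Ω`, hence so does `y`.
theorem mem_of_apply_mem_closure (hΩ : IsAttractorBlock f Ω) (hf : Continuous f)
    (hy : y ∈ chainRecurrentSet f) (hfy : f y ∈ closure Ω) : y ∈ Ω :=
  hΩ.mem_of_apply_mem hf hy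
    ((hΩ.preimage hf).mem_of_apply_mem hf hy (hΩ.mapsTo_closure hfy))

end IsAttractorBlock

/-- The points that lie in the sets `Ω i` with `i ∈ σ` and whose images avoid the closures of the
other sets. For attractor blocks `Ω i` and a homeomorphism `f`, these open sets separate the chain
recurrent points according to the blocks containing them. -/
def blockCell {X ι : Type*} [TopologicalSpace X] (f : X → X) (Ω : ι → Set X) (σ : Set ι) : Set X :=
  {y | (∀ i ∈ σ, y ∈ Ω i) ∧ ∀ i ∉ σ, f y ∉ closure (Ω i)}

section Cells

variable {X ι : Type*} [TopologicalSpace X] {Ω : ι → Set X} {σ τ : Set ι}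

theorem isOpen_blockCell [Finite ι] {f : X → X} (hf : Continuous f) (hΩ : ∀ i, IsOpen (Ω i))
    (σ : Set ι) : IsOpen (blockCell f Ω σ) := by
  have : blockCell f Ω σ = (⋂ i ∈ σ, Ω i) ∩ ⋂ i ∈ σᶜ, f ⁻¹' (closure (Ω i))ᶜ := by
    ext y; simp [blockCell]
  rw [this]
  exact (σ.toFinite.isOpen_biInter fun i _ => hΩ i).inter
    (σᶜ.toFinite.isOpen_biInter fun i _ => isClosed_closure.isOpen_compl.preimage hf)

theorem disjoint_closure_blockCell_of_not_subset {f : X → X} (hf : Continuous f)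
    (hΩ : ∀ i, IsAttractorBlock f (Ω i)) (h : ¬ σ ⊆ τ) :
    Disjoint (closure (blockCell f Ω σ)) (closure (blockCell f Ω τ)) := by
  obtain ⟨i, hσ, hτ⟩ := not_subset.1 h
  have hle : closure (blockCell f Ω σ) ⊆ closure (Ω i) := closure_mono fun z hz => hz.1 i hσ
  have hle' : closure (blockCell f Ω τ) ⊆ f ⁻¹' (Ω i)ᶜ :=
    closure_minimal (fun z hz hfz => hz.2 i hτ (subset_closure hfz))
      ((hΩ i).isOpen.isClosed_compl.preimage hf)
  exact disjoint_left.2 fun y hy hy' => hle' hy' ((hΩ i).mapsTo_closure (hle hy))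

theorem disjoint_closure_blockCell {f : X → X} (hf : Continuous f)
    (hΩ : ∀ i, IsAttractorBlock f (Ω i)) (h : σ ≠ τ) :
    Disjoint (closure (blockCell f Ω σ)) (closure (blockCell f Ω τ)) := by
  by_cases hστ : σ ⊆ τ
  · exact (disjoint_closure_blockCell_of_not_subset hf hΩ fun hτσ => h (hστ.antisymm hτσ)).symm
  · exact disjoint_closure_blockCell_of_not_subset hf hΩ hστ

theorem mem_blockCell_setOf {X : Type*} [PseudoMetricSpace X] [CompactSpace X] {f : X → X}
    {Ω : ι → Set X} (hf : Continuous f) (hΩ : ∀ i, IsAttractorBlock f (Ω i)) {y : X}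
    (hy : y ∈ chainRecurrentSet f) : y ∈ blockCell f Ω {i | y ∈ Ω i} :=
  ⟨fun _ hi => hi, fun i hi hfy => hi ((hΩ i).mem_of_apply_mem_closure hf hy hfy)⟩

theorem mem_of_symm_iterate_mem {f : X ≃ₜ X} {S : Set X} (hS : MapsTo f S S) {m : ℕ} {y : X}
    (hy : f.symm^[m] y ∈ S) : y ∈ S := by
  have h := hS.iterate m hy
  rwa [Function.LeftInverse.iterate f.apply_symm_apply m y] at h

variable {f : X ≃ₜ X}

theorem subset_of_inter_unstableSet_nonempty (hΩ : ∀ i, MapsTo f (Ω i) (Ω i))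
    (h : (blockCell f Ω τ ∩ unstableSet f (blockCell f Ω σ)).Nonempty) : σ ⊆ τ := by
  obtain ⟨x, hxτ, m, hm⟩ := h
  intro i hi
  by_contra hτ
  exact hxτ.2 i hτ (subset_closure (hΩ i (mem_of_symm_iterate_mem (hΩ i) (hm.1 i hi))))

theorem mem_blockCell_of_iterate (hΩ : ∀ i, MapsTo f (Ω i) (Ω i)) {x : X} {m q : ℕ}
    (hm : f^[m] x ∈ blockCell f Ω σ) (hq : f.symm^[q] x ∈ blockCell f Ω σ) :
    x ∈ blockCell f Ω σ := by
  refine ⟨fun i hi => mem_of_symm_iterate_mem (hΩ i) (hq.1 i hi), fun i hi hfx => hm.2 i hi ?_⟩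
  have h := ((hΩ i).closure f.continuous).iterate m hfx
  rwa [← Function.iterate_succ_apply, Function.iterate_succ_apply'] at h

theorem not_isLongCycle_of_leads_lt {α : Type*} [Preorder α] {k : ℕ} {V : Fin k → Set X}
    {φ : Fin k → α} (hφ : ∀ i j, Leads f V i j → φ i < φ j) (r : ℕ) (s : Fin r → Fin k) :
    ¬ IsLongCycle f V r s := by
  rintro ⟨hr, hs⟩
  have : Nonempty (Fin r) := ⟨⟨0, by omega⟩⟩
  obtain ⟨_, ⟨a, rfl⟩, ha⟩ := (finite_range (φ ∘ s)).exists_maximal (range_nonempty _)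
  exact (hφ _ _ (hs a)).not_ge (ha (mem_range_self (finRotate r a)) (hφ _ _ (hs a)).le)

theorem hasNoCycles_blockCell (hΩ : ∀ i, MapsTo f (Ω i) (Ω i)) {k : ℕ} {φ : Fin k → Set ι}
    (hφ : φ.Injective) : HasNoCycles f fun a => blockCell f Ω (φ a) := by
  refine ⟨not_isLongCycle_of_leads_lt (φ := φ) fun a b h => ?_, ?_⟩
  · exact (subset_of_inter_unstableSet_nonempty hΩ h.2).lt_of_ne (hφ.ne h.1)
  · rintro a ⟨x, hx, m, q, -, -, hm, hq⟩
    exact hx (mem_blockCell_of_iterate hΩ hm hq)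

end Cells

section Decomposition

variable {X : Type*} [MetricSpace X] [CompactSpace X] {f : X ≃ₜ X} {U : Set X}

theorem isOpenDecomposition_blockCell {ι : Type*} [Finite ι] {Ω : ι → Set X}
    (hΩ : ∀ i, IsAttractorBlock f (Ω i)) {k : ℕ} (φ : Fin k ≃ Set ι) :
    IsOpenDecomposition f fun a => blockCell f Ω (φ a) where
  isOpen _ := isOpen_blockCell f.continuous (fun i => (hΩ i).isOpen) _
  disjoint_closure _ _ h := disjoint_closure_blockCell f.continuous hΩ (φ.injective.ne h)
  subset_iUnion y hy := by
    refine mem_iUnion.2 ⟨φ.symm {i | y ∈ Ω i}, ?_⟩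
    rw [φ.apply_symm_apply]
    exact mem_blockCell_setOf f.continuous hΩ
      (generalizedRecurrentSet_subset_chainRecurrentSet f hy)

theorem exists_finite_isAttractorBlock_cover (hU : IsOpen U) (h : chainRecurrentSet f ⊆ U) :
    ∃ (t : Finset X) (Ω : t → Set X), (∀ i, IsAttractorBlock f (Ω i)) ∧
      ∀ y ∉ U, ∃ i, f y ∈ Ω i ∧ y ∉ closure (Ω i) := by
  have hchain : ∀ x ∉ U, ∃ ε > 0, x ∉ chainReach f ε x := fun x hx => by
    simpa [chainRecurrentSet] using fun hxr => hx (h hxr)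
  choose! ε hε hεx using hchain
  let Ω : X → Set X := fun x => chainReach f (ε x / 2) x
  have hΩ : ∀ x ∉ U, IsAttractorBlock f (Ω x) := fun x hx =>
    isAttractorBlock_chainReach f.continuous (half_pos (hε x hx))
  obtain ⟨t, htU, ht⟩ := hU.isClosed_compl.isCompact.elim_nhds_subcover
    (fun x => f ⁻¹' Ω x ∩ (closure (Ω x))ᶜ) fun x hx =>
      (((hΩ x hx).isOpen.preimage f.continuous).inter isClosed_closure.isOpen_compl).mem_nhds
        ⟨apply_mem_chainReach (half_pos (hε x hx)),
          fun hcl => hεx x hx (mem_chainReach_of_mem_closure (hε x hx) hcl)⟩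
  refine ⟨t, fun x => Ω x, fun x => hΩ x (htU x x.2), fun y hy => ?_⟩
  obtain ⟨x, hx, hyx⟩ := mem_iUnion₂.1 (ht hy)
  exact ⟨⟨x, hx⟩, hyx⟩

theorem exists_isOpenDecomposition_hasNoCycles (hU : IsOpen U) (h : chainRecurrentSet f ⊆ U) :
    ∃ (k : ℕ) (V : Fin k → Set X), IsOpenDecomposition f V ∧ HasNoCycles f V ∧
      generalizedRecurrentSet f ⊆ ⋃ i, V i ∧ ⋃ i, V i ⊆ U := by
  classical
  obtain ⟨t, Ω, hΩ, hcover⟩ := exists_finite_isAttractorBlock_cover hU h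
  let φ := (Fintype.equivFin (Set t)).symm
  have hV := isOpenDecomposition_blockCell hΩ φ
  refine ⟨_, _, hV, hasNoCycles_blockCell (fun i => (hΩ i).mapsTo) φ.injective,
    hV.subset_iUnion, iUnion_subset fun a y hy => ?_⟩
  by_contra hyU
  obtain ⟨i, hfy, hyi⟩ := hcover y hyU
  by_cases hi : i ∈ φ a
  · exact hyi (subset_closure (hy.1 i hi))
  · exact hy.2 i hi (subset_closure hfy)

end Decomposition

/-! ### Closing of chains -/

section ClosedChains

variable {X : Type*} {R : X → X → Prop} {x y : X}

theorem exists_nodup_isChain_of_reflTransGen (h : ReflTransGen R x y) :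
    ∃ l : List X, (x :: l).IsChain R ∧ (x :: l).getLast (List.cons_ne_nil x l) = y ∧
      (x :: l).Nodup := by
  induction h using ReflTransGen.head_induction_on with
  | refl => exact ⟨[], by simp⟩
  | @head a b hab _ ih =>
    obtain ⟨l, hchain, hlast, hnodup⟩ := ih
    by_cases ha : a ∈ b :: l
    · obtain ⟨l₁, l₂, hl⟩ := List.append_of_mem ha
      refine ⟨l₂, (hl ▸ hchain).right_of_append, ?_, (hl ▸ hnodup).of_append_right⟩
      simpa only [hl, List.getLast_append_of_ne_nil _ (List.cons_ne_nil a l₂)] using hlast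
    · exact ⟨b :: l, hchain.cons_cons hab, by rwa [List.getLast_cons], hnodup.cons ha⟩

theorem exists_injective_cycle_of_transGen (h : TransGen R x x) :
    ∃ (n : ℕ) (c : Fin (n + 1) → X), c.Injective ∧ c 0 = x ∧ ∀ i, R (c i) (c (i + 1)) := by
  obtain ⟨y, hxy, hyx⟩ := TransGen.tail'_iff.1 h
  obtain ⟨l, hchain, hlast, hnodup⟩ := exists_nodup_isChain_of_reflTransGen hxy
  refine ⟨l.length, (x :: l).get, List.nodup_iff_injective_get.1 hnodup, rfl, fun i => ?_⟩
  induction i using Fin.lastCases with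
  | last =>
    have hget : (x :: l).get (Fin.last l.length) = y :=
      (List.getLast_eq_getElem _).symm.trans hlast
    rwa [Fin.last_add_one, hget]
  | cast i =>
    rw [Fin.coeSucc_eq_succ]
    exact hchain.getElem i (by simp)

end ClosedChains

/-- The generalized homogeneity of topological dynamics, uniformly over all finite families of
points: points that are moved by little can be moved by a homeomorphism close to the identity. -/
def IsGeneralizedHomogeneous (X : Type*) [PseudoMetricSpace X] : Prop :=
  ∀ η : ℝ, 0 < η → ∃ ε > 0, ∀ (ι : Type) [Finite ι] (p q : ι → X), p.Injective → q.Injective →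
    (∀ i, dist (p i) (q i) < ε) →
      ∃ h : X ≃ₜ X, (∀ x, dist (h x) x < η) ∧ ∀ i, h (p i) = q i

theorem IsGeneralizedHomogeneous.exists_homeomorph_mem_periodicPts {X : Type*}
    [PseudoMetricSpace X] (hX : IsGeneralizedHomogeneous X) (f : X ≃ₜ X) {x : X}
    (hx : x ∈ chainRecurrentSet f) {η : ℝ} (hη : 0 < η) :
    ∃ g : X ≃ₜ X, (∀ y, dist (g y) (f y) < η) ∧ x ∈ Function.periodicPts g := by
  obtain ⟨ε, hε, hmove⟩ := hX η hη
  obtain ⟨n, c, hc, rfl, hstep⟩ := exists_injective_cycle_of_transGen (hx ε hε)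
  obtain ⟨h, hh, hhc⟩ := hmove (Fin (n + 1)) (f ∘ c) (fun i => c (i + 1)) (f.injective.comp hc)
    (hc.comp (add_left_injective 1)) hstep
  have hsemi : Function.Semiconj c (· + 1) (f.trans h) := fun i => (hhc i).symm
  obtain ⟨m, hm, hmper⟩ := (add_left_injective (1 : Fin (n + 1))).mem_periodicPts 0
  exact ⟨f.trans h, fun y => hh (f y), m, hm, hmper.map hsemi⟩

theorem dist_homeo_lt_iff {X : Type*} [MetricSpace X] [CompactSpace X] {f g : X ≃ₜ X} {η : ℝ}
    (hη : 0 < η) : dist f g < η ↔ ∀ x, dist (f x) (g x) < η :=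
  ContinuousMap.dist_lt_iff (f := ⟨f, f.continuous⟩) (g := ⟨g, g.continuous⟩) hη

theorem IsGeneralizedHomogeneous.chainRecurrentSet_subset {X : Type*} [MetricSpace X]
    [CompactSpace X] (hX : IsGeneralizedHomogeneous X) {f : X ≃ₜ X} (hf : NoGRExplosions f)
    {U : Set X} (hU : IsOpen U) (hfU : generalizedRecurrentSet f ⊆ U) :
    chainRecurrentSet f ⊆ U := by
  intro x hx
  obtain ⟨N, hN, hNU⟩ := hf U hU hfU
  obtain ⟨η, hη, hηN⟩ := Metric.mem_nhds_iff.1 hN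
  obtain ⟨g, hgf, hxg⟩ := hX.exists_homeomorph_mem_periodicPts f hx hη
  exact hNU g (hηN ((dist_homeo_lt_iff hη).2 hgf))
    (periodicPts_subset_generalizedRecurrentSet g hxg)

/-! ### Moving points in a normed space -/

section Shears

variable {E : Type*} [NormedAddCommGroup E] [NormedSpace ℝ E]

theorem bijective_add_smul_const [CompleteSpace E] {χ : E → ℝ} {K : ℝ≥0} (hχ : LipschitzWith K χ)
    {v : E} (hv : K * ‖v‖₊ < 1) : Function.Bijective fun z => z + χ z • v := by
  refine (Function.bijective_iff_existsUnique _).2 fun y => ?_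
  have hc : ContractingWith (K * ‖v‖₊) fun z => y - χ z • v := by
    refine ⟨hv, LipschitzWith.of_dist_le_mul fun a b => ?_⟩
    rw [dist_sub_left, dist_eq_norm, ← sub_smul, norm_smul, NNReal.coe_mul, coe_nnnorm,
      mul_right_comm, ← dist_eq_norm]
    exact mul_le_mul_of_nonneg_right (hχ.dist_le_mul a b) (norm_nonneg v)
  refine ⟨hc.fixedPoint, ?_, fun z hz => hc.fixedPoint_unique (sub_eq_of_eq_add hz.symm)⟩
  exact (sub_eq_iff_eq_add.1 hc.fixedPoint_isFixedPt).symm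

-- The map `ℓ` is invariant, and on each of its fibres the direction of the displacement is
-- constant.
theorem bijective_shear [CompleteSpace E] {F : Type*} [AddCommGroup F] [Module ℝ F]
    (ℓ : E →ₗ[ℝ] F) {χ : E → ℝ} {φ : F → E} {K r : ℝ≥0} (hχ : LipschitzWith K χ)
    (hℓφ : ∀ t, ℓ (φ t) = 0) (hφ : ∀ t, ‖φ t‖₊ ≤ r) (hKr : K * r < 1) :
    Function.Bijective fun z => z + χ z • φ (ℓ z) := by
  have hℓ : ∀ z t, ℓ (z + χ z • φ t) = ℓ z := fun z t => by simp [hℓφ]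
  have hfibre : ∀ t, Function.Bijective fun z => z + χ z • φ t := fun t =>
    bijective_add_smul_const hχ ((mul_le_mul_right (hφ t) K).trans_lt hKr)
  refine ⟨fun x y hxy => ?_, fun y => ?_⟩
  · have hℓxy : ℓ x = ℓ y := by
      simpa only [hℓ] using congrArg ℓ hxy
    exact (hfibre (ℓ y)).1 (by simpa only [hℓxy] using hxy)
  · obtain ⟨z, hz⟩ := (hfibre (ℓ y)).2 y
    have hℓz : ℓ z = ℓ y := (hℓ z _).symm.trans (congrArg ℓ hz)
    exact ⟨z, by simpa only [hℓz] using hz⟩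

theorem isHomeomorph_of_eqOn_compl_bounded {X : Type*} [MetricSpace X] [ProperSpace X]
    {S : X → X} (hS : Continuous S) (hbij : S.Bijective) {s : Set X} (hs : Bornology.IsBounded s)
    (hid : EqOn S id sᶜ) : IsHomeomorph S := by
  have htend : Tendsto S (cocompact X) (cocompact X) := by
    rw [← Metric.cobounded_eq_cocompact]
    exact tendsto_id.congr'
      (mem_of_superset (Bornology.isBounded_def.1 hs) fun x hx => (hid hx).symm)
  exact isHomeomorph_iff_continuous_isClosedMap_bijective.2
    ⟨hS, (isProperMap_iff_tendsto_cocompact.2 ⟨hS, htend⟩).isClosedMap, hbij⟩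

theorem exists_bounded_interpolation {ι Y W : Type*} [Finite ι] [TopologicalSpace Y] [T4Space Y]
    [NormedAddCommGroup W] [NormedSpace ℝ W] [FiniteDimensional ℝ W] {t : ι → Y}
    (ht : t.Injective) {d : ι → W} {r : ℝ} (hr : 0 < r) (hd : ∀ i, ‖d i‖ ≤ r) :
    ∃ φ : C(Y, W), (∀ y, ‖φ y‖ ≤ r) ∧ ∀ i, φ (t i) = d i := by
  let : TopologicalSpace ι := ⊥
  have : DiscreteTopology ι := ⟨rfl⟩
  have := Metric.instTietzeExtensionClosedBall (E := W) ℝ 0 hr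
  have hemb : IsClosedEmbedding t := .of_continuous_injective_isClosedMap
    continuous_of_discreteTopology ht fun s _ => (s.toFinite.image t).isClosed
  obtain ⟨φ, hφ, hφd⟩ := ContinuousMap.exists_extension_forall_mem hemb
    ⟨d, continuous_of_discreteTopology⟩ (t := Metric.closedBall 0 r)
    (fun i => mem_closedBall_zero_iff.2 (hd i))
  exact ⟨φ, fun y => mem_closedBall_zero_iff.1 (hφ y), fun i => DFunLike.congr_fun hφd i⟩

theorem exists_homeomorph_shear [FiniteDimensional ℝ E] (ℓ : E →L[ℝ] ℝ) {s : Set E}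
    (hs : Bornology.IsBounded s) {r R : ℝ} (hr : 0 < r) (hrR : r < R) {ι : Type*} [Finite ι]
    {a d : ι → E} (ha : (ℓ ∘ a).Injective) (hℓd : ∀ i, ℓ (d i) = 0) (hdr : ∀ i, ‖d i‖ ≤ r)
    (has : ∀ i, a i ∈ s ∨ d i = 0) :
    ∃ S : E ≃ₜ E, (∀ z ∉ Metric.thickening R s, S z = z) ∧ (∀ z, dist (S z) z ≤ r) ∧
      ∀ i, S (a i) = a i + d i := by
  have := FiniteDimensional.complete ℝ E
  have := FiniteDimensional.proper ℝ E
  have hR : 0 < R := hr.trans hrR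
  obtain ⟨φ, hφr, hφd⟩ := exists_bounded_interpolation (W := LinearMap.ker (ℓ : E →ₗ[ℝ] ℝ)) ha
    (d := fun i => ⟨d i, hℓd i⟩) hr hdr
  let χ : E → ℝ≥0 := thickenedIndicator hR s
  have hχ : LipschitzWith R.toNNReal⁻¹ fun z => (χ z : ℝ) := lipschitzWith_thickenedIndicator hR s
  let S : E → E := fun z => z + (χ z : ℝ) • (φ (ℓ z) : E)
  have hSbij : S.Bijective := bijective_shear (ℓ : E →ₗ[ℝ] ℝ) (r := r.toNNReal) hχ
    (fun t => (φ t).2) (fun t => NNReal.le_toNNReal_of_coe_le (hφr t))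
    ((inv_mul_lt_iff₀ (Real.toNNReal_pos.2 hR)).2
      (by rwa [mul_one, Real.toNNReal_lt_toNNReal_iff hR]))
  have hScont : Continuous S := by fun_prop
  have hSid : ∀ z ∉ Metric.thickening R s, S z = z := fun z hz => by
    have hχz : χ z = 0 := thickenedIndicator_zero hR s hz
    simp [S, hχz]
  refine ⟨(isHomeomorph_of_eqOn_compl_bounded hScont hSbij hs.thickening hSid).homeomorph, hSid,
    fun z => ?_, fun i => ?_⟩
  · calc dist (S z) z = χ z * ‖φ (ℓ z)‖ := by simp [S, norm_smul]
      _ ≤ 1 * r := by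
        gcongr
        · exact thickenedIndicator_le_one hR s z
        · exact hφr _
      _ = r := one_mul r
  · change a i + (χ (a i) : ℝ) • (φ (ℓ (a i)) : E) = a i + d i
    rw [show φ (ℓ (a i)) = ⟨d i, hℓd i⟩ from hφd i]
    rcases has i with hi | hi
    · have hχi : χ (a i) = 1 := thickenedIndicator_one hR s hi
      simp [hχi]
    · simp [hi]

end Shears

section GenericFunctionals

variable {E : Type*} [NormedAddCommGroup E] [NormedSpace ℝ E]

theorem dense_setOf_apply_ne_zero {x : E} (hx : x ≠ 0) : Dense {u : E →L[ℝ] ℝ | u x ≠ 0} := by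
  refine interior_eq_empty_iff_dense_compl.1 (not_nonempty_iff_eq_empty.1 fun hne => ?_)
  obtain ⟨u, hu⟩ := SeparatingDual.exists_ne_zero (R := ℝ) hx
  have htop := Submodule.eq_top_of_nonempty_interior'
    (LinearMap.ker (ContinuousLinearMap.apply ℝ ℝ x : (E →L[ℝ] ℝ) →ₗ[ℝ] ℝ)) hne
  exact hu (LinearMap.mem_ker.1 (htop ▸ Submodule.mem_top : u ∈ _))

theorem dense_setOf_injective_comp {ι : Type*} [Finite ι] {p : ι → E} (hp : p.Injective) :
    Dense {u : E →L[ℝ] ℝ | (u ∘ p).Injective} := by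
  have hd : Dense (⋂ z ∈ {z : ι × ι | z.1 ≠ z.2}, {u : E →L[ℝ] ℝ | u (p z.1 - p z.2) ≠ 0}) :=
    dense_biInter_of_isOpen (fun z _ => isOpen_ne_fun (by fun_prop) continuous_const)
      (toFinite _).countable fun z hz => dense_setOf_apply_ne_zero (sub_ne_zero.2 (hp.ne hz))
  refine hd.mono fun u hu i j hij => by_contra fun hne => ?_
  exact mem_iInter₂.1 hu (i, j) hne (by simpa [sub_eq_zero] using hij)

theorem exists_isOpen_dual_vector (hE : 1 < Module.finrank ℝ E) :
    ∃ C > 0, ∃ O : Set ((E →L[ℝ] ℝ) × (E →L[ℝ] ℝ)), IsOpen O ∧ O.Nonempty ∧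
      ∀ z ∈ O, ∃ w, z.1 w = 1 ∧ z.2 w = 0 ∧ ‖z.1‖ * ‖w‖ ≤ C := by
  have := Module.finite_of_finrank_pos (zero_lt_one.trans hE)
  let b := Module.finBasis ℝ E
  let i₀ : Fin (Module.finrank ℝ E) := ⟨0, zero_lt_one.trans hE⟩
  let i₁ : Fin (Module.finrank ℝ E) := ⟨1, hE⟩
  let ℓ₀ := LinearMap.toContinuousLinearMap (b.coord i₀)
  let ℓ₁ := LinearMap.toContinuousLinearMap (b.coord i₁)
  -- `F v` spans the intersection of `ker v` with the plane of `b i₀` and `b i₁`.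
  let F : (E →L[ℝ] ℝ) → E := fun v => v (b i₁) • b i₀ - v (b i₀) • b i₁
  have hF : ∀ v : E →L[ℝ] ℝ, v (F v) = 0 := fun v => by simp [F, mul_comm]
  have hF₁ : F ℓ₁ = b i₀ := by simp [F, ℓ₁, i₀, i₁]
  have hC : 0 < ‖ℓ₀‖ * ‖b i₀‖ + 1 := by positivity
  refine ⟨_, hC, {z | ‖z.1‖ * ‖F z.2‖ < (‖ℓ₀‖ * ‖b i₀‖ + 1) * z.1 (F z.2)},
    isOpen_lt (by fun_prop) (by fun_prop), ⟨(ℓ₀, ℓ₁), ?_⟩, fun ⟨u, v⟩ hz => ?_⟩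
  · simp [hF₁, ℓ₀]
  · have hpos : 0 < u (F v) := (mul_pos_iff_of_pos_left hC).1
      ((mul_nonneg (norm_nonneg u) (norm_nonneg (F v))).trans_lt hz)
    refine ⟨(u (F v))⁻¹ • F v, by simp [hpos.ne'], by simp [hF], ?_⟩
    rw [norm_smul, norm_inv, Real.norm_of_nonneg hpos.le, mul_left_comm, inv_mul_le_iff₀ hpos,
      mul_comm (u (F v))]
    exact hz.le

theorem exists_separating_functionals (hE : 1 < Module.finrank ℝ E) :
    ∃ C > 0, ∀ {ι : Type} [Finite ι] {p q : ι → E}, p.Injective → q.Injective →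
      ∃ (u v : E →L[ℝ] ℝ) (w : E), (u ∘ p).Injective ∧ (v ∘ q).Injective ∧
        u w = 1 ∧ v w = 0 ∧ ‖u‖ * ‖w‖ ≤ C := by
  obtain ⟨C, hC, O, hO, hne, hw⟩ := exists_isOpen_dual_vector hE
  refine ⟨C, hC, fun {ι} _ {p q} hp hq => ?_⟩
  obtain ⟨⟨u, v⟩, hzO, hu, hv⟩ :=
    ((dense_setOf_injective_comp hp).prod (dense_setOf_injective_comp hq)).inter_open_nonempty
      O hO hne
  obtain ⟨w, hw⟩ := hw _ hzO
  exact ⟨u, v, w, hu, hv, hw⟩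

end GenericFunctionals

/-- Small displacements of finitely many points of `s` are realized by homeomorphisms that are
supported in `K` and close to the identity, uniformly over all finite families of points. A member
of the family with `p i = q i` may lie anywhere; it is an obstacle, which has to stay fixed. -/
def HasSmallMoves {X : Type*} [PseudoMetricSpace X] (s K : Set X) : Prop :=
  ∀ η : ℝ, 0 < η → ∃ ε > 0, ∀ (ι : Type) [Finite ι] (p q : ι → X),
    Pairwise (Function.onFun Disjoint fun i => ({p i, q i} : Set X)) →
    (∀ i, p i ∈ s ∨ p i = q i) → (∀ i, dist (p i) (q i) < ε) →
      ∃ h : X ≃ₜ X, (∀ x ∉ K, h x = x) ∧ (∀ x, dist (h x) x < η) ∧ ∀ i, h (p i) = q i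

theorem injective_of_pairwise_disjoint_pair {ι X : Type*} {p q : ι → X}
    (h : Pairwise (Function.onFun Disjoint fun i => ({p i, q i} : Set X))) :
    p.Injective ∧ q.Injective :=
  ⟨fun i j hij => by_contra fun hne =>
      Set.disjoint_left.1 (h hne) (mem_insert (p i) _) (by simp [hij]),
    fun i j hij => by_contra fun hne =>
      Set.disjoint_left.1 (h hne) (mem_insert_of_mem (p i) (mem_singleton (q i))) (by simp [hij])⟩

theorem exists_homeomorph_two_shears {E : Type*} [NormedAddCommGroup E] [NormedSpace ℝ E]
    [FiniteDimensional ℝ E] {s : Set E} (hs : Bornology.IsBounded s) {r R : ℝ} (hr : 0 < r)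
    (hrR : r < R) {ι : Type*} [Finite ι] {p d₁ d₂ : ι → E} {u v : E →L[ℝ] ℝ}
    (hu : (u ∘ p).Injective) (hv : (v ∘ (p + d₁)).Injective) (hud : ∀ i, u (d₁ i) = 0)
    (hvd : ∀ i, v (d₂ i) = 0) (hd₁ : ∀ i, ‖d₁ i‖ ≤ r) (hd₂ : ∀ i, ‖d₂ i‖ ≤ r)
    (hps : ∀ i, p i ∈ s ∨ d₁ i = 0 ∧ d₂ i = 0) :
    ∃ S : E ≃ₜ E, (∀ z ∉ Metric.thickening (R + R) s, S z = z) ∧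
      (∀ z, dist (S z) z ≤ r + r) ∧ ∀ i, S (p i) = p i + d₁ i + d₂ i := by
  obtain ⟨S, hS, hSr, hSp⟩ :=
    exists_homeomorph_shear u hs hr hrR hu hud hd₁ fun i => (hps i).imp_right And.left
  have hmem : ∀ i, p i + d₁ i ∈ Metric.thickening R s ∨ d₂ i = 0 := fun i =>
    (hps i).imp (fun hi => Metric.mem_thickening_iff.2
      ⟨p i, hi, by simpa using (hd₁ i).trans_lt hrR⟩) And.right
  obtain ⟨T, hT, hTr, hTp⟩ := exists_homeomorph_shear v hs.thickening hr hrR hv hvd hd₂ hmem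
  have hsub := Metric.thickening_thickening_subset R R s
  refine ⟨S.trans T, fun z hz => ?_, fun z => ?_, fun i => ?_⟩
  · have hzR : z ∉ Metric.thickening R (Metric.thickening R s) := fun h => hz (hsub h)
    have hzs : z ∉ Metric.thickening R s := fun h =>
      hzR (Metric.self_subset_thickening (hr.trans hrR) _ h)
    rw [Homeomorph.trans_apply, hS z hzs, hT z hzR]
  · exact (dist_triangle _ (S z) _).trans (add_le_add (hTr _) (hSr z))
  · rw [Homeomorph.trans_apply, hSp]
    exact hTp i

theorem hasSmallMoves_thickening {E : Type*} [NormedAddCommGroup E] [NormedSpace ℝ E]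
    (hE : 1 < Module.finrank ℝ E) {s : Set E} (hs : Bornology.IsBounded s) {δ : ℝ} (hδ : 0 < δ) :
    HasSmallMoves s (Metric.thickening δ s) := by
  intro η hη
  have := Module.finite_of_finrank_pos (zero_lt_one.trans hE)
  obtain ⟨C, hC, hsep⟩ := exists_separating_functionals hE
  obtain ⟨r, hr, hrlt⟩ := exists_between (half_pos (lt_min hδ hη))
  have hrδ : r < δ / 2 := hrlt.trans_le (by gcongr; exact min_le_left δ η)
  have hrη : r < η / 2 := hrlt.trans_le (by gcongr; exact min_le_right δ η)
  refine ⟨r / (1 + C), by positivity, fun ι _ p q hpq hps hdist => ?_⟩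
  obtain ⟨hp, hq⟩ := injective_of_pairwise_disjoint_pair hpq
  obtain ⟨u, v, w, hup, hvq, huw, hvw, hCw⟩ := hsep hp hq
  -- The displacement `q i - p i` is split along `ker u` and `ker v`, which contains `w`.
  let d₂ : ι → E := fun i => u (q i - p i) • w
  let d₁ : ι → E := fun i => q i - p i - d₂ i
  have hsum : ∀ i, p i + d₁ i + d₂ i = q i := fun i => by simp only [d₁]; abel
  have hnorm : ∀ i, (1 + C) * ‖q i - p i‖ ≤ r := fun i => by
    rw [← dist_eq_norm, dist_comm, ← le_div_iff₀' (by positivity)]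
    exact (hdist i).le
  have hd₂ : ∀ i, ‖d₂ i‖ ≤ C * ‖q i - p i‖ := fun i => calc
    ‖d₂ i‖ = ‖u (q i - p i)‖ * ‖w‖ := norm_smul _ _
    _ ≤ ‖u‖ * ‖q i - p i‖ * ‖w‖ := by gcongr; exact u.le_opNorm _
    _ = ‖u‖ * ‖w‖ * ‖q i - p i‖ := by ring
    _ ≤ C * ‖q i - p i‖ := by gcongr
  obtain ⟨S, hS, hSr, hSp⟩ := exists_homeomorph_two_shears hs hr hrδ (d₁ := d₁) (d₂ := d₂) (v := v)
    hup
    (by convert hvq using 1; ext i; simp [d₁, d₂, hvw]) (fun i => by simp [d₁, d₂, huw])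
    (fun i => by simp [d₂, hvw])
    (fun i => by linarith [norm_sub_le (q i - p i) (d₂ i), hd₂ i, hnorm i])
    (fun i => by linarith [norm_nonneg (q i - p i), hd₂ i, hnorm i])
    (fun i => (hps i).imp_right fun h => by simp [d₁, d₂, h])
  rw [add_halves] at hS
  exact ⟨S, hS, fun z => (hSr z).trans_lt (by linarith), fun i => (hSp i).trans (hsum i)⟩

/-! ### Moving points in charts -/

namespace HasSmallMoves

variable {X : Type*} [PseudoMetricSpace X] {s t K L : Set X}

theorem mono (h : HasSmallMoves t K) (hst : s ⊆ t) (hKL : K ⊆ L) : HasSmallMoves s L := by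
  intro η hη
  obtain ⟨ε, hε, hmove⟩ := h η hη
  refine ⟨ε, hε, fun ι _ p q hpq hps hdist => ?_⟩
  obtain ⟨h, hid, hh⟩ := hmove ι p q hpq (fun i => (hps i).imp_left fun hi => hst hi) hdist
  exact ⟨h, fun x hx => hid x fun hxK => hx (hKL hxK), hh⟩

theorem empty : HasSmallMoves (∅ : Set X) K := fun η hη =>
  ⟨1, one_pos, fun _ _ _ _ _ hps _ => ⟨.refl X, fun _ _ => rfl, fun x => by simpa using hη,
    fun i => (hps i).resolve_left (notMem_empty _)⟩⟩

-- The points of `s` are moved first, while the others are obstacles, and conversely afterwards.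
theorem union (hs : HasSmallMoves s K) (ht : HasSmallMoves t K) : HasSmallMoves (s ∪ t) K := by
  classical
  intro η hη
  obtain ⟨ε, hε, hmove⟩ := hs (η / 2) (half_pos hη)
  obtain ⟨ε', hε', hmove'⟩ := ht (η / 2) (half_pos hη)
  refine ⟨min ε ε', lt_min hε hε', fun ι _ p q hpq hpst hdist => ?_⟩
  let r : ι → X := fun i => if p i ∈ s then q i else p i
  have hr_mem : ∀ i, p i ∈ s → r i = q i := fun i hi => if_pos hi
  have hr_notMem : ∀ i, p i ∉ s → r i = p i := fun i hi => if_neg hi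
  have hr : ∀ i, r i = q i ∨ r i = p i := fun i => ite_eq_or_eq _ _ _
  have hpr_sub : ∀ i, ({p i, r i} : Set X) ⊆ {p i, q i} := fun i => by
    rcases hr i with h | h <;> simp [h]
  have hrq_sub : ∀ i, ({r i, q i} : Set X) ⊆ {p i, q i} := fun i => by
    rcases hr i with h | h <;> simp [h]
  obtain ⟨h, hK, hη₁, hpr⟩ := hmove ι p r (fun i j hij => (hpq hij).mono (hpr_sub i) (hpr_sub j))
    (fun i => or_iff_not_imp_left.2 fun hi => (hr_notMem i hi).symm) fun i => by
      by_cases hi : p i ∈ s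
      · exact hr_mem i hi ▸ (hdist i).trans_le (min_le_left _ _)
      · rwa [hr_notMem i hi, dist_self]
  obtain ⟨h', hK', hη₂, hrq⟩ := hmove' ι r q (fun i j hij => (hpq hij).mono (hrq_sub i) (hrq_sub j))
    (fun i => by
      by_cases hi : p i ∈ s
      · exact Or.inr (hr_mem i hi)
      · rw [hr_notMem i hi]
        exact (hpst i).imp_left fun hst => hst.resolve_left hi) fun i => by
      by_cases hi : p i ∈ s
      · rwa [hr_mem i hi, dist_self]
      · exact hr_notMem i hi ▸ (hdist i).trans_le (min_le_right _ _)
  refine ⟨h.trans h', fun x hx => ?_, fun x => ?_, fun i => ?_⟩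
  · rw [Homeomorph.trans_apply, hK x hx, hK' x hx]
  · exact (dist_triangle _ (h x) _).trans_lt
      ((add_lt_add (hη₂ (h x)) (hη₁ x)).trans_eq (add_halves η))
  · rw [Homeomorph.trans_apply, hpr, hrq]

end HasSmallMoves

section Transport

variable {X E : Type*} [TopologicalSpace X] [TopologicalSpace E] {h : E ≃ₜ E} {K s : Set E}

theorem mapsTo_of_eqOn_compl (hid : ∀ z ∉ K, h z = z) (hKs : K ⊆ s) : MapsTo h s s := by
  intro z hz
  by_contra hhz
  have hfix : h z = z := h.injective (hid (h z) fun hK => hhz (hKs hK))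
  exact hhz (hfix.symm ▸ hz)

open Classical in
/-- The map that acts as `h` in the chart `e` and fixes the points outside the domain of `e`. -/
noncomputable def chartLift (e : OpenPartialHomeomorph X E) (h : E ≃ₜ E) : X → X :=
  e.source.piecewise (e.symm ∘ h ∘ e) id

variable {e : OpenPartialHomeomorph X E}

theorem chartLift_of_mem_source {x : X} (hx : x ∈ e.source) :
    chartLift e h x = e.symm (h (e x)) :=
  if_pos hx

theorem chartLift_of_notMem_source {x : X} (hx : x ∉ e.source) : chartLift e h x = x :=
  if_neg hx

theorem chartLift_of_notMem_image_symm (hid : ∀ z ∉ K, h z = z) {x : X} (hx : x ∉ e.symm '' K) :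
    chartLift e h x = x := by
  by_cases hxe : x ∈ e.source
  · have hexK : e x ∉ K := fun hK => hx ⟨e x, hK, e.left_inv hxe⟩
    rw [chartLift_of_mem_source hxe, hid _ hexK, e.left_inv hxe]
  · exact chartLift_of_notMem_source hxe

theorem leftInverse_chartLift_symm (hid : ∀ z ∉ K, h z = z) (hKe : K ⊆ e.target) :
    Function.LeftInverse (chartLift e h.symm) (chartLift e h) := by
  intro x
  by_cases hx : x ∈ e.source
  · have hmem : h (e x) ∈ e.target := mapsTo_of_eqOn_compl hid hKe (e.map_source hx)
    rw [chartLift_of_mem_source hx, chartLift_of_mem_source (e.map_target hmem),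
      e.right_inv hmem, h.symm_apply_apply, e.left_inv hx]
  · rw [chartLift_of_notMem_source hx, chartLift_of_notMem_source hx]

theorem continuous_chartLift [T2Space X] (hK : IsCompact K) (hid : ∀ z ∉ K, h z = z)
    (hKe : K ⊆ e.target) : Continuous (chartLift e h) := by
  have hcompact : IsCompact (e.symm '' K) := hK.image_of_continuousOn (e.continuousOn_symm.mono hKe)
  refine continuous_iff_continuousAt.2 fun x => ?_
  by_cases hx : x ∈ e.source
  · have hcont : ContinuousOn (e.symm ∘ h ∘ e) e.source :=
      e.continuousOn_symm.comp (h.continuous.comp_continuousOn e.continuousOn)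
        ((mapsTo_of_eqOn_compl hid hKe).comp e.mapsTo)
    exact (hcont.congr fun y hy => chartLift_of_mem_source hy).continuousAt
      (e.open_source.mem_nhds hx)
  · have hxK : x ∉ e.symm '' K := fun hxK => hx ((e.mapsTo_symm.mono_left hKe).image_subset hxK)
    exact continuousAt_id.congr (mem_of_superset (hcompact.isClosed.isOpen_compl.mem_nhds hxK)
      fun y hy => (chartLift_of_notMem_image_symm hid hy).symm)

/-- `chartLift e h` as a homeomorphism, for `h` supported in a compact subset `K` of the target
of `e`. -/
noncomputable def chartLiftHomeomorph [T2Space X] (e : OpenPartialHomeomorph X E) (h : E ≃ₜ E)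
    (hK : IsCompact K) (hid : ∀ z ∉ K, h z = z) (hKe : K ⊆ e.target) : X ≃ₜ X :=
  have hid' : ∀ z ∉ K, h.symm z = z := fun z hz => h.symm_apply_eq.2 (hid z hz).symm
  { toFun := chartLift e h
    invFun := chartLift e h.symm
    left_inv := leftInverse_chartLift_symm hid hKe
    right_inv := leftInverse_chartLift_symm hid' hKe
    continuous_toFun := continuous_chartLift hK hid hKe
    continuous_invFun := continuous_chartLift hK hid' hKe }

end Transport

section Manifold

variable {X E : Type*} [MetricSpace X] [MetricSpace E] {e : OpenPartialHomeomorph X E}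

theorem exists_forall_dist_chart_lt {s : Set X} (hs : IsCompact s) (hse : s ⊆ e.source) {η : ℝ}
    (hη : 0 < η) :
    ∃ ε > 0, ∀ x ∈ s, ∀ y, dist x y < ε → y ∈ e.source ∧ dist (e x) (e y) < η := by
  obtain ⟨δ, hδ, hδe⟩ := hs.exists_thickening_subset_open e.open_source hse
  obtain ⟨ε, hε, hdist⟩ := Metric.mem_uniformity_dist.1
    (hs.uniformContinuousAt_of_continuousAt e (fun x hx => e.continuousAt (hse hx))
      (Metric.dist_mem_uniformity hη))
  refine ⟨min δ ε, lt_min hδ hε, fun x hx y hxy => ⟨hδe ?_, ?_⟩⟩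
  · exact Metric.mem_thickening_iff.2 ⟨x, hx, dist_comm x y ▸ hxy.trans_le (min_le_left _ _)⟩
  · exact hdist (hxy.trans_le (min_le_right _ _)) hx

theorem exists_forall_dist_chartLift_lt {K : Set E} (hK : IsCompact K) (hKe : K ⊆ e.target)
    {η : ℝ} (hη : 0 < η) :
    ∃ ε > 0, ∀ h : E ≃ₜ E, (∀ z ∉ K, h z = z) → (∀ z, dist (h z) z < ε) →
      ∀ x, dist (chartLift e h x) x < η := by
  obtain ⟨ε, hε, hdist⟩ := Metric.uniformContinuousOn_iff.1
    (hK.uniformContinuousOn_of_continuous (e.continuousOn_symm.mono hKe)) η hη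
  refine ⟨ε, hε, fun h hid hh x => ?_⟩
  by_cases hx : x ∈ e.symm '' K
  · obtain ⟨z, hz, rfl⟩ := hx
    rw [chartLift_of_mem_source (e.map_target (hKe hz)), e.right_inv (hKe hz)]
    exact hdist _ (mapsTo_of_eqOn_compl hid subset_rfl hz) _ hz (hh z)
  · rwa [chartLift_of_notMem_image_symm hid hx, dist_self]

theorem HasSmallMoves.image_symm {s K : Set E} (h : HasSmallMoves s K) (hs : IsCompact s)
    (hse : s ⊆ e.target) (hK : IsCompact K) (hKe : K ⊆ e.target) :
    HasSmallMoves (e.symm '' s) (e.symm '' K) := by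
  intro η hη
  have hss : e.symm '' s ⊆ e.source := (e.mapsTo_symm.mono_left hse).image_subset
  obtain ⟨η', hη', hlift⟩ := exists_forall_dist_chartLift_lt hK hKe hη
  obtain ⟨ε', hε', hmove⟩ := h η' hη'
  obtain ⟨ε, hε, hchart⟩ := exists_forall_dist_chart_lt
    (hs.image_of_continuousOn (e.continuousOn_symm.mono hse)) hss hε'
  refine ⟨ε, hε, fun ι _ p q hpq hps hdist => ?_⟩
  have hsource : ∀ i, p i ∈ e.source → q i ∈ e.source ∧ dist (e (p i)) (e (q i)) < ε' :=
    fun i hi => (hps i).elim (fun his => hchart _ his _ (hdist i))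
      fun hpqi => hpqi ▸ ⟨hi, by rwa [dist_self]⟩
  obtain ⟨k, hkK, hkη, hk⟩ := hmove {i // p i ∈ e.source} (fun i => e (p i)) (fun i => e (q i))
    (fun i j hij => by
      simp only [Function.onFun, ← image_pair]
      exact (hpq (Subtype.coe_ne_coe.2 hij)).image e.injOn
        (pair_subset i.2 (hsource i i.2).1) (pair_subset j.2 (hsource j j.2).1))
    (fun i => (hps i).imp (fun ⟨z, hz, hzi⟩ => by rwa [← hzi, e.right_inv (hse hz)])
      (congrArg e)) fun i => (hsource i i.2).2
  refine ⟨chartLiftHomeomorph e k hK hkK hKe, fun x hx => chartLift_of_notMem_image_symm hkK hx,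
    hlift k hkK hkη, fun i => ?_⟩
  change chartLift e k (p i) = q i
  by_cases hi : p i ∈ e.source
  · rw [chartLift_of_mem_source hi, hk ⟨i, hi⟩, e.left_inv (hsource i hi).1]
  · rw [chartLift_of_notMem_source hi]
    exact (hps i).resolve_left fun his => hi (hss his)

theorem exists_mem_nhds_hasSmallMoves {E : Type*} [NormedAddCommGroup E] [NormedSpace ℝ E]
    [ChartedSpace E X] (hE : 1 < Module.finrank ℝ E) (x : X) :
    ∃ t ∈ 𝓝 x, HasSmallMoves t (univ : Set X) := by
  have := Module.finite_of_finrank_pos (zero_lt_one.trans hE)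
  have := FiniteDimensional.proper_real E
  set e := chartAt E x
  have hx : x ∈ e.source := mem_chart_source E x
  obtain ⟨ρ, hρ, hρe⟩ := Metric.nhds_basis_closedBall.mem_iff.1
    (e.open_target.mem_nhds (e.map_source hx))
  have hsub : Metric.closedBall (e x) (ρ / 2) ⊆ Metric.closedBall (e x) ρ :=
    Metric.closedBall_subset_closedBall (half_le_self hρ.le)
  have hthick : Metric.thickening (ρ / 2) (Metric.closedBall (e x) (ρ / 2)) ⊆
      Metric.closedBall (e x) ρ := by
    rw [thickening_closedBall (half_pos hρ) (half_pos hρ).le, add_halves]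
    exact Metric.ball_subset_closedBall
  have hmoves : HasSmallMoves (Metric.closedBall (e x) (ρ / 2)) (Metric.closedBall (e x) ρ) :=
    (hasSmallMoves_thickening hE Metric.isBounded_closedBall (half_pos hρ)).mono subset_rfl hthick
  refine ⟨e.symm '' Metric.closedBall (e x) (ρ / 2), ?_,
    (hmoves.image_symm (isCompact_closedBall _ _) (hsub.trans hρe) (isCompact_closedBall _ _)
      hρe).mono subset_rfl (subset_univ _)⟩
  simpa only [e.left_inv hx] using e.symm.image_mem_nhds (e.map_source hx)
    (Metric.closedBall_mem_nhds (e x) (half_pos hρ))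

theorem hasSmallMoves_univ (E : Type*) [NormedAddCommGroup E] [NormedSpace ℝ E]
    [ChartedSpace E X] [CompactSpace X] (hE : 1 < Module.finrank ℝ E) :
    HasSmallMoves (univ : Set X) univ :=
  isCompact_univ.induction_on (p := fun t => HasSmallMoves t univ) .empty
    (fun _ _ hst ht => ht.mono hst subset_rfl) (fun _ _ => .union) fun x _ => by
      simpa only [nhdsWithin_univ] using exists_mem_nhds_hasSmallMoves hE x

theorem perfectSpace_of_chartedSpace (H M : Type*) [TopologicalSpace H] [TopologicalSpace M]
    [ChartedSpace H M] [PerfectSpace H] : PerfectSpace M := by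
  refine perfectSpace_iff_forall_not_isolated.2 fun x => ⟨fun hbot => ?_⟩
  set e := chartAt H x
  have hx : {x} ⊆ e.source := singleton_subset_iff.2 (mem_chart_source H x)
  have hopen : IsOpen ({e x} : Set H) := by
    rw [← image_singleton]
    exact e.isOpen_image_of_subset_source ((isOpen_singleton_iff_punctured_nhds x).2 hbot) hx
  exact PerfectSpace.not_isolated (e x) |>.ne ((isOpen_singleton_iff_punctured_nhds _).1 hopen)

theorem exists_injective_forall_mem {ι α : Type*} [Finite ι] {s : ι → Set α}
    (hs : ∀ i, (s i).Infinite) : ∃ z : ι → α, z.Injective ∧ ∀ i, z i ∈ s i := by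
  classical
  cases nonempty_fintype ι
  choose t hts htcard using fun i => (hs i).exists_subset_card_eq (Fintype.card ι)
  obtain ⟨z, hz, hzt⟩ := (Finset.all_card_le_biUnion_card_iff_exists_injective t).1 fun a => by
    obtain rfl | ⟨i, hi⟩ := a.eq_empty_or_nonempty
    · simp
    · exact a.card_le_univ.trans
        ((htcard i).symm.le.trans (Finset.card_le_card (Finset.subset_biUnion_of_mem t hi)))
  exact ⟨z, hz, fun i => hts i (hzt i)⟩

theorem pairwise_disjoint_pair {ι α : Type*} {p z : ι → α} (hp : p.Injective) (hz : z.Injective)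
    (hpz : ∀ i, z i ∉ range p) :
    Pairwise (Function.onFun Disjoint fun i => ({p i, z i} : Set α)) := fun i j hij => by
  have hpz' : ∀ i j, p i ≠ z j := fun i j h => hpz j ⟨i, h⟩
  simp [Function.onFun, (hp.ne hij).symm, (hz.ne hij).symm, hpz', (hpz' _ _).symm]

-- The pairs `{p i, q i}` may overlap, so the points move through intermediate positions `z i`
-- that avoid all the `p j` and `q j`.
theorem HasSmallMoves.isGeneralizedHomogeneous [PerfectSpace X]
    (h : HasSmallMoves (univ : Set X) univ) : IsGeneralizedHomogeneous X := by
  intro η hη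
  obtain ⟨ε, hε, hmove⟩ := h (η / 2) (half_pos hη)
  refine ⟨ε / 2, half_pos hε, fun ι _ p q hp hq hdist => ?_⟩
  obtain ⟨z, hz, hzs⟩ := exists_injective_forall_mem
    (s := fun i => Metric.ball (p i) (ε / 2) \ (range p ∪ range q)) fun i =>
      (infinite_of_mem_nhds (p i) (Metric.ball_mem_nhds _ (half_pos hε))).sdiff
        ((finite_range p).union (finite_range q))
  have hzp : ∀ i, dist (z i) (p i) < ε / 2 := fun i => (hzs i).1
  obtain ⟨h₁, -, hη₁, hpz⟩ := hmove ι p z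
    (pairwise_disjoint_pair hp hz fun i hi => (hzs i).2 (Or.inl hi)) (fun _ => Or.inl trivial)
    fun i => dist_comm (z i) (p i) ▸ (hzp i).trans (half_lt_self hε)
  obtain ⟨h₂, -, hη₂, hzq⟩ := hmove ι z q
    (by simpa only [pair_comm] using
      pairwise_disjoint_pair hq hz fun i hi => (hzs i).2 (Or.inr hi))
    (fun _ => Or.inl trivial) fun i =>
      (dist_triangle _ (p i) _).trans_lt ((add_lt_add (hzp i) (hdist i)).trans_eq (add_halves ε))
  refine ⟨h₁.trans h₂, fun x => ?_, fun i => ?_⟩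
  · exact (dist_triangle _ (h₁ x) _).trans_lt
      ((add_lt_add (hη₂ (h₁ x)) (hη₁ x)).trans_eq (add_halves η))
  · rw [Homeomorph.trans_apply, hpz, hzq]

theorem isGeneralizedHomogeneous_of_chartedSpace (E : Type*) [NormedAddCommGroup E]
    [NormedSpace ℝ E] [ChartedSpace E X] [CompactSpace X] (hE : 1 < Module.finrank ℝ E) :
    IsGeneralizedHomogeneous X := by
  have := Module.nontrivial_of_finrank_pos (zero_lt_one.trans hE)
  have := perfectSpace_of_module ℝ E
  have := perfectSpace_of_chartedSpace E X
  exact (hasSmallMoves_univ E hE).isGeneralizedHomogeneous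

end Manifold

end GenRec

theorem mainTheorem2_general {X : Type*} [MetricSpace X] [CompactSpace X]
    (hX : GenRec.IsGeneralizedHomogeneous X) (f : X ≃ₜ X) (hexp : GenRec.NoGRExplosions f)
    (U : Set X) (hU : IsOpen U) (hGU : GenRec.generalizedRecurrentSet f ⊆ U) :
    ∃ (k : ℕ) (V : Fin k → Set X), GenRec.IsOpenDecomposition f V ∧ GenRec.HasNoCycles f V ∧
      GenRec.generalizedRecurrentSet f ⊆ ⋃ i, V i ∧ ⋃ i, V i ⊆ U :=
  GenRec.exists_isOpenDecomposition_hasNoCycles hU (hX.chainRecurrentSet_subset hexp hU hGU)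

theorem mainTheorem2 {M : Type*} [MetricSpace M] [CompactSpace M] (n : ℕ) (hn : 2 ≤ n)
    [ChartedSpace (EuclideanSpace ℝ (Fin n)) M] (f : M ≃ₜ M)
    (hf : GenRec.generalizedRecurrentSet f ≠ Set.univ) (hexp : GenRec.NoGRExplosions f)
    (U : Set M) (hU : IsOpen U) (hGU : GenRec.generalizedRecurrentSet f ⊆ U) :
    ∃ (k : ℕ) (V : Fin k → Set M), GenRec.IsOpenDecomposition f V ∧ GenRec.HasNoCycles f V ∧
      GenRec.generalizedRecurrentSet f ⊆ ⋃ i, V i ∧ ⋃ i, V i ⊆ U := by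
  have hn' : 1 < Module.finrank ℝ (EuclideanSpace ℝ (Fin n)) := by
    rw [finrank_euclideanSpace_fin]
    exact hn
  exact mainTheorem2_general
    (GenRec.isGeneralizedHomogeneous_of_chartedSpace (EuclideanSpace ℝ (Fin n)) hn') f hexp U hU hGU
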